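/- For $0<\alpha\le 1$, a random variable $X=(X_1,\dots,X_n)$ over $\{-1,1\}^n$ is called an \emph{$\alpha$-strong SV (Santha--Vazirani) source} if for every $i\in\{1,\dots,n\}$ and every fixing $x_{-i}$ of $X_{-i}=(X_1,\dots,X_{i-1},X_{i+1},\dots,X_n)$ that occurs with positive probability, $$\frac{\Pr[X_i=1\mid X_{-i}=x_{-i}]}{\Pr[X_i=-1\mid X_{-i}=x_{-i}]}\in[\alpha,1/\alpha].$$ For a discrete random variable $Z$ let $H_\infty(Z)=-\log\max_z\Pr[Z=z]$; all logarithms are to base $2$. For $x,y\in\{-1,1\}^n$ let $\langle x,y\rangle=\sum_{i=1}^n x_iy_i\in\mathbb Z$. There exist universal constants $c_1,c_2>0$ such that for every integer $n\ge 2$, every real $\varepsilon\ge 0$, and every two independent $e^{-\varepsilon}$-strong SV sources $X$ and $Y$ over $\{-1,1\}^n$, $$H_\infty(\langle X,Y\rangle)\ \ge\ \log\left(\frac{\sqrt n}{e^{c_1\varepsilon}\,c_1\log n}\right)$$ and $$H_\infty\bigl(\langle X,Y\rangle \bmod \lceil c_2\sqrt n\,\rceil\bigr)\ \ge\ \log\left(\frac{\sqrt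 n}{e^{c_1\varepsilon}\,c_1\log n}\right).$$ -/

import Mathlib

open MeasureTheory ProbabilityTheory

/-- The integer inner product `⟨x, y⟩ = ∑ i, x i * y i` of two vectors in `{-1, 1} ^ n`
(the units of `ℤ` are exactly `1` and `-1`). -/
def signInner {n : ℕ} (x y : Fin n → ℤˣ) : ℤ :=
  ∑ i, (x i : ℤ) * (y i : ℤ)

/-- `X = (X_1, …, X_n)`, a random variable over `{-1, 1} ^ n`, is an `a`-strong Santha-Vazirani
source (`0 < a`): for every coordinate `i` and every fixing of the other coordinates that has
positive probability, `P(X_i = 1 | X_{-i} = x_{-i}) / P(X_i = -1 | X_{-i} = x_{-i})` lies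
in `[a, 1 / a]`. A vanishing denominator is excluded, since the quotient is then `0 < a`. -/
def IsStrongSVSource {Ω : Type*} [MeasurableSpace Ω] (μ : Measure Ω) {n : ℕ}
    (a : ℝ) (X : Ω → Fin n → ℤˣ) : Prop :=
  ∀ (i : Fin n) (x : Fin n → ℤˣ), μ {ω | ∀ j, j ≠ i → X ω j = x j} ≠ 0 →
    (μ[|{ω | ∀ j, j ≠ i → X ω j = x j}]).real {ω | X ω i = 1} /
      (μ[|{ω | ∀ j, j ≠ i → X ω j = x j}]).real {ω | X ω i = -1} ∈ Set.Icc a (1 / a)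

/-- The min-entropy, in bits, of a discrete random variable `Z`:
`H_∞(Z) = -log₂ (max_z P(Z = z))`. -/
noncomputable def minEntropy {Ω : Type*} [MeasurableSpace Ω] (μ : Measure Ω) {S : Type*}
    (Z : Ω → S) : ℝ :=
  -Real.logb 2 (⨆ z : S, μ.real {ω | Z ω = z})

/-! Both entropy bounds follow from one estimate: every residue class modulo `m = ⌈√n⌉` has
probability `O(C ^ 2 * log n / √n)` with `C = exp ε`. By Fourier inversion modulo `m` this reduces
to decay of the characteristic function `φ(t)` of `⟨X, Y⟩`, namely `|φ(t)| * √n * |sin 2t| ≤ 3 * C ^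
2` (`norm_sum_innerChar_le`).

For the decay, let `G x` be the mean of `exp (i t ⟨x, Y⟩)`. The coordinates of `Y` are dependent, so
each `y_i` is replaced by the martingale difference `d_i = y_i / (2 P(y_i | prefix))` (`signDiff`).
It is bounded by `C`, and `y_i d_i = 1 - μ_i d_i` with `μ_i` the predictable conditional mean
(`sign_mul_signDiff`). Let `g_i`, `k_i` be the coefficients of the character against `d_i`, `μ_i
d_i`. Both families are orthogonal, so Bessel and Cauchy-Schwarz give `∑ |g_i|, ∑ |k_i| ≤ √n * C`.
Flipping `x_i` multiplies the character by `cos 2t - i x_i y_i sin 2t`, so `g_i` at the flipped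
point equals `cos 2t * g_i - i x_i sin 2t * (G - k_i)`. Hence `|sin 2t| * |G|` is at most a sum of
three small coefficients. Averaging over `i` and `X`, where a flip costs a factor `C`, gives the
decay.

At `t = 2πj/m` the bound is a cosecant sum of size `m log m` (`sum_min_inv_sin_le`), which is the
source of the logarithm. -/

/-! ### Coordinate flips. -/

/-- The sign vector `x` with its `i`-th coordinate negated. -/
def flipAt {n : ℕ} (i : Fin n) (x : Fin n → ℤˣ) : Fin n → ℤˣ :=
  Function.update x i (-x i)

@[simp] lemma flipAt_same {n : ℕ} (i : Fin n) (x : Fin n → ℤˣ) : flipAt i x i = -x i := by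
  simp [flipAt]

lemma flipAt_of_ne {n : ℕ} {i j : Fin n} (h : j ≠ i) (x : Fin n → ℤˣ) :
    flipAt i x j = x j := by
  simp [flipAt, h]

@[simp] lemma flipAt_flipAt {n : ℕ} (i : Fin n) (x : Fin n → ℤˣ) :
    flipAt i (flipAt i x) = x := by
  ext j
  by_cases h : j = i
  · subst h; simp
  · simp [flipAt_of_ne h]

lemma flipAt_involutive {n : ℕ} (i : Fin n) :
    Function.Involutive (flipAt i : (Fin n → ℤˣ) → Fin n → ℤˣ) :=
  flipAt_flipAt i

lemma sum_flipAt {n : ℕ} {M : Type*} [AddCommMonoid M] (i : Fin n) (f : (Fin n → ℤˣ) → M) :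
    ∑ x, f (flipAt i x) = ∑ x, f x :=
  Equiv.sum_comp (flipAt_involutive i).toPerm f

lemma signInner_flipAt {n : ℕ} (i : Fin n) (x y : Fin n → ℤˣ) :
    signInner (flipAt i x) y = signInner x y - 2 * ((x i : ℤ) * (y i : ℤ)) := by
  have h : signInner (flipAt i x) y - signInner x y
      = ∑ j, if j = i then -2 * ((x i : ℤ) * (y i : ℤ)) else 0 := by
    rw [signInner, signInner, ← Finset.sum_sub_distrib]
    refine Finset.sum_congr rfl fun j _ => ?_
    split_ifs with hj
    · subst hj; simp; ring
    · simp [flipAt_of_ne hj]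
  rw [Finset.sum_ite_eq' Finset.univ i] at h
  simp only [Finset.mem_univ, if_true] at h
  linarith

/-! ### Prefix cylinders and their masses. -/

/-- `x` and `y` have the same first `k` coordinates. -/
def PrefixEq {n : ℕ} (k : ℕ) (x y : Fin n → ℤˣ) : Prop :=
  ∀ l : Fin n, l.val < k → x l = y l

instance {n : ℕ} (k : ℕ) (x y : Fin n → ℤˣ) : Decidable (PrefixEq k x y) := by
  unfold PrefixEq; infer_instance

lemma PrefixEq.symm {n k : ℕ} {x y : Fin n → ℤˣ} (h : PrefixEq k x y) : PrefixEq k y x :=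
  fun l hl => (h l hl).symm

lemma PrefixEq.trans {n k : ℕ} {x y z : Fin n → ℤˣ} (h : PrefixEq k x y)
    (h' : PrefixEq k y z) : PrefixEq k x z :=
  fun l hl => (h l hl).trans (h' l hl)

lemma PrefixEq.mono {n k k' : ℕ} {x y : Fin n → ℤˣ} (h : PrefixEq k x y) (hk : k' ≤ k) :
    PrefixEq k' x y :=
  fun l hl => h l (hl.trans_le hk)

lemma prefixEq_flipAt {n k : ℕ} {j : Fin n} (h : k ≤ j.val) (x : Fin n → ℤˣ) :
    PrefixEq k (flipAt j x) x := by
  intro l hl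
  exact flipAt_of_ne (fun e => by subst e; omega) x

lemma prefixEq_flipAt_flipAt {n k : ℕ} (j : Fin n) (x y : Fin n → ℤˣ) :
    PrefixEq k (flipAt j x) (flipAt j y) ↔ PrefixEq k x y := by
  have key : ∀ x y : Fin n → ℤˣ, PrefixEq k x y → PrefixEq k (flipAt j x) (flipAt j y) := by
    intro x y h l hl
    by_cases e : l = j
    · subst e; simp [h l hl]
    · simp [flipAt_of_ne e, h l hl]
  exact ⟨fun h => by simpa using key _ _ h, key x y⟩

/-- The `q`-mass of the sign vectors with the same first `k` coordinates as `y`. -/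
noncomputable def prefixMass {n : ℕ} (q : (Fin n → ℤˣ) → ℝ) (k : ℕ) (y : Fin n → ℤˣ) : ℝ :=
  ∑ z, if PrefixEq k z y then q z else 0

lemma prefixMass_congr {n k : ℕ} (q : (Fin n → ℤˣ) → ℝ) {x y : Fin n → ℤˣ}
    (h : PrefixEq k x y) : prefixMass q k x = prefixMass q k y := by
  unfold prefixMass
  refine Finset.sum_congr rfl fun z _ => ?_
  have : PrefixEq k z x ↔ PrefixEq k z y := ⟨fun h' => h'.trans h, fun h' => h'.trans h.symm⟩
  simp [this]

lemma prefixMass_pos {n k : ℕ} {q : (Fin n → ℤˣ) → ℝ} (hq : ∀ y, 0 < q y) (y : Fin n → ℤˣ) :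
    0 < prefixMass q k y := by
  refine Finset.sum_pos' (fun z _ => ?_) ⟨y, Finset.mem_univ _, ?_⟩
  · split_ifs; exacts [(hq z).le, le_rfl]
  · rw [if_pos (show PrefixEq k y y from fun l _ => rfl)]; exact hq y

lemma prefixEq_succ {n : ℕ} (j : Fin n) (z y : Fin n → ℤˣ) :
    PrefixEq (j.val + 1) z y ↔ PrefixEq j.val z y ∧ z j = y j := by
  refine ⟨fun h => ⟨h.mono (Nat.le_succ _), h j (Nat.lt_succ_self _)⟩, fun h l hl => ?_⟩
  rcases Nat.lt_succ_iff_lt_or_eq.1 hl with h' | h'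
  · exact h.1 l h'
  · have : l = j := Fin.ext h'
    rw [this, h.2]

lemma prefixMass_succ_add {n : ℕ} (q : (Fin n → ℤˣ) → ℝ) (j : Fin n) (y : Fin n → ℤˣ) :
    prefixMass q (j.val + 1) y + prefixMass q (j.val + 1) (flipAt j y)
      = prefixMass q j.val y := by
  unfold prefixMass
  rw [← Finset.sum_add_distrib]
  refine Finset.sum_congr rfl fun z _ => ?_
  have h1 : PrefixEq j.val z (flipAt j y) ↔ PrefixEq j.val z y :=
    ⟨fun h => h.trans (prefixEq_flipAt le_rfl y),
      fun h => h.trans (prefixEq_flipAt le_rfl y).symm⟩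
  simp only [prefixEq_succ, h1, flipAt_same]
  by_cases h : PrefixEq j.val z y
  · rcases Int.units_eq_one_or (z j) with hz | hz <;>
      rcases Int.units_eq_one_or (y j) with hy | hy <;> simp [h, hz, hy]
  · simp [h]

/-- The flip maps one cylinder bijectively onto the other, so the marginals inherit the ratio bound
of `q`. -/
lemma prefixMass_flipAt_le {n k : ℕ} {q : (Fin n → ℤˣ) → ℝ} {C : ℝ} (j : Fin n)
    (hC : ∀ y, q (flipAt j y) ≤ C * q y) (y : Fin n → ℤˣ) :
    prefixMass q k (flipAt j y) ≤ C * prefixMass q k y := by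
  unfold prefixMass
  rw [← sum_flipAt j, Finset.mul_sum]
  refine Finset.sum_le_sum fun z _ => ?_
  simp only [prefixEq_flipAt_flipAt]
  split_ifs
  · exact hC z
  · simp

/-- A function of the first `k + 1` coordinates which is odd in the last of them integrates to
zero after division by the mass of the prefix. -/
lemma sum_div_prefixMass_eq_zero {n : ℕ} {q : (Fin n → ℤˣ) → ℝ} (hq : ∀ y, 0 < q y) (j : Fin n)
    (c : (Fin n → ℤˣ) → ℝ) (hc : ∀ x y, PrefixEq (j.val + 1) x y → c x = c y)
    (hodd : ∀ y, c (flipAt j y) = -c y) :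
    ∑ y, q y * (c y / prefixMass q (j.val + 1) y) = 0 := by
  set Q := prefixMass q (j.val + 1) with hQ
  set N := prefixMass (fun _ : Fin n → ℤˣ => (1 : ℝ)) (j.val + 1) with hN
  have hQpos : ∀ y, 0 < Q y := prefixMass_pos hq
  have hNpos : ∀ y, 0 < N y := prefixMass_pos fun _ => one_pos
  have hNflip : ∀ y, N (flipAt j y) = N y := by
    intro y
    simp only [hN, prefixMass]
    rw [← sum_flipAt j]
    simp only [prefixEq_flipAt_flipAt]
  -- Spread each term evenly over the `N y` vectors of its cylinder and exchange the sums: on a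
  -- cylinder `q / Q` and `1 / N` both have total mass one. The new weight `1 / N` is invariant
  -- under the flip, so oddness applies.
  have h1 : ∑ y, q y * (c y / Q y) = ∑ y, c y / N y := by
    calc ∑ y, q y * (c y / Q y)
        = ∑ y, ∑ z, if PrefixEq (j.val + 1) z y then q y * c y / (Q y * N y) else 0 := by
          refine Finset.sum_congr rfl fun y _ => ?_
          have : N y = ∑ z, if PrefixEq (j.val + 1) z y then (1 : ℝ) else 0 := rfl
          have e : ∀ z, (if PrefixEq (j.val + 1) z y then q y * c y / (Q y * N y) else 0)
              = q y * c y / (Q y * N y) * (if PrefixEq (j.val + 1) z y then (1 : ℝ) else 0) := by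
            intro z; split_ifs <;> simp
          simp only [e]
          rw [← Finset.mul_sum, ← this]
          have := (hQpos y).ne'
          have := (hNpos y).ne'
          field_simp
      _ = ∑ z, ∑ y, if PrefixEq (j.val + 1) y z then q y * (c z / (Q z * N z)) else 0 := by
          rw [Finset.sum_comm]
          refine Finset.sum_congr rfl fun z _ => Finset.sum_congr rfl fun y _ => ?_
          by_cases h : PrefixEq (j.val + 1) y z
          · rw [if_pos h, if_pos h.symm, hc y z h, hQ, hN, prefixMass_congr q h,
              prefixMass_congr _ h]
            ring
          · rw [if_neg h, if_neg fun h' => h h'.symm]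
      _ = ∑ z, c z / N z := by
          refine Finset.sum_congr rfl fun z _ => ?_
          have : Q z = ∑ y, if PrefixEq (j.val + 1) y z then q y else 0 := rfl
          have e : ∀ y, (if PrefixEq (j.val + 1) y z then q y * (c z / (Q z * N z)) else 0)
              = (if PrefixEq (j.val + 1) y z then q y else 0) * (c z / (Q z * N z)) := by
            intro y; split_ifs <;> simp
          simp only [e]
          rw [← Finset.sum_mul, ← this]
          have := (hQpos z).ne'
          have := (hNpos z).ne'
          field_simp
  have h2 : ∑ y, c y / N y = -∑ y, c y / N y := by
    conv_lhs => rw [← sum_flipAt j]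
    simp only [hodd, hNflip, neg_div, Finset.sum_neg_distrib]
  rw [h1]
  linarith

/-! ### Martingale differences of the second source. -/

/-- The martingale difference `y_j / (2 P(y_j | y_0, …, y_{j-1}))`. -/
noncomputable def signDiff {n : ℕ} (q : (Fin n → ℤˣ) → ℝ) (j : Fin n) (y : Fin n → ℤˣ) : ℝ :=
  ((y j : ℤ) : ℝ) * prefixMass q j.val y / (2 * prefixMass q (j.val + 1) y)

/-- The conditional mean of `y_j` given `y_0, …, y_{j-1}`. -/
noncomputable def prefixMean {n : ℕ} (q : (Fin n → ℤˣ) → ℝ) (j : Fin n) (y : Fin n → ℤˣ) : ℝ :=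
  ((y j : ℤ) : ℝ) * (prefixMass q (j.val + 1) y - prefixMass q (j.val + 1) (flipAt j y)) /
    prefixMass q j.val y

lemma units_cast_mul_self (u : ℤˣ) : ((u : ℤ) : ℝ) * ((u : ℤ) : ℝ) = 1 := by
  rcases Int.units_eq_one_or u with h | h <;> simp [h]

lemma abs_units_cast (u : ℤˣ) : |((u : ℤ) : ℝ)| = 1 := by
  rcases Int.units_eq_one_or u with h | h <;> simp [h]

/-- The left side is `1 / (2 P(y_j | prefix))`, and the parent cylinder is the sum of its two
halves. The error term is a predictable multiple of `signDiff`, so it is again controlled by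
orthogonality. -/
lemma sign_mul_signDiff {n : ℕ} {q : (Fin n → ℤˣ) → ℝ} (hq : ∀ y, 0 < q y) (j : Fin n)
    (y : Fin n → ℤˣ) :
    ((y j : ℤ) : ℝ) * signDiff q j y = 1 - prefixMean q j y * signDiff q j y := by
  have h0 := prefixMass_succ_add q j y
  have h1 := prefixMass_pos (k := j.val) hq y
  have h2 := prefixMass_pos (k := j.val + 1) hq y
  have h3 := units_cast_mul_self (y j)
  unfold signDiff prefixMean
  set s := ((y j : ℤ) : ℝ)
  set A := prefixMass q j.val y
  set B := prefixMass q (j.val + 1) y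
  set D := prefixMass q (j.val + 1) (flipAt j y)
  have e1 : s * (s * A / (2 * B)) = A / (2 * B) := by
    rw [show s * (s * A / (2 * B)) = (s * s) * (A / (2 * B)) by ring, h3, one_mul]
  have e2 : s * (B - D) / A * (s * A / (2 * B)) = (B - D) / (2 * B) := by
    rw [show s * (B - D) / A * (s * A / (2 * B)) = (s * s) * ((B - D) / A * (A / (2 * B))) by
      ring, h3]
    field_simp
  rw [e1, e2]
  field_simp
  linarith

/-- The two halves of a cylinder have mass ratio at most `C`, so the absolute value is at most `(1 +
C) / 2 ≤ C`. -/
lemma abs_signDiff_le {n : ℕ} {q : (Fin n → ℤˣ) → ℝ} (hq : ∀ y, 0 < q y) {C : ℝ} (hC1 : 1 ≤ C)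
    (j : Fin n) (hC : ∀ y, q (flipAt j y) ≤ C * q y) (y : Fin n → ℤˣ) :
    |signDiff q j y| ≤ C := by
  have h0 := prefixMass_succ_add q j y
  have h1 := prefixMass_pos (k := j.val) hq y
  have h2 := prefixMass_pos (k := j.val + 1) hq y
  have h3 := prefixMass_flipAt_le (k := j.val + 1) j hC y
  rw [signDiff, abs_div, abs_mul, abs_units_cast, one_mul, abs_of_pos h1, abs_of_pos (by linarith),
    div_le_iff₀ (by linarith)]
  nlinarith

lemma abs_prefixMean_le {n : ℕ} {q : (Fin n → ℤˣ) → ℝ} (hq : ∀ y, 0 < q y)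
    (j : Fin n) (y : Fin n → ℤˣ) : |prefixMean q j y| ≤ 1 := by
  have h0 := prefixMass_succ_add q j y
  have h1 := prefixMass_pos (k := j.val) hq y
  have h2 := prefixMass_pos (k := j.val + 1) hq y
  have h3 := prefixMass_pos (k := j.val + 1) hq (flipAt j y)
  rw [prefixMean, abs_div, abs_mul, abs_units_cast, one_mul, abs_of_pos h1, div_le_one h1, abs_le]
  constructor <;> linarith

/-- Predictability: flipping `y_j` changes both the sign and the order of the difference, so the
value does not depend on `y_j`. -/
lemma prefixMean_congr {n : ℕ} (q : (Fin n → ℤˣ) → ℝ) (j : Fin n) {x y : Fin n → ℤˣ}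
    (h : PrefixEq j.val x y) : prefixMean q j x = prefixMean q j y := by
  have hflip : ∀ y, prefixMean q j (flipAt j y) = prefixMean q j y := by
    intro y
    simp only [prefixMean, flipAt_same, flipAt_flipAt,
      prefixMass_congr q (prefixEq_flipAt le_rfl y)]
    push_cast
    ring
  have key : ∀ x y : Fin n → ℤˣ, PrefixEq (j.val + 1) x y →
      prefixMean q j x = prefixMean q j y := by
    intro x y h
    simp only [prefixMean, prefixMass_congr q h, h j (Nat.lt_succ_self _),
      prefixMass_congr q (h.mono (Nat.le_succ _)),
      prefixMass_congr q ((prefixEq_flipAt_flipAt j x y).2 h)]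
  by_cases e : x j = y j
  · exact key x y ((prefixEq_succ j x y).2 ⟨h, e⟩)
  · rw [← hflip y]
    refine key _ _ ((prefixEq_succ j _ _).2 ⟨h.trans (prefixEq_flipAt le_rfl y).symm, ?_⟩)
    rw [flipAt_same]
    exact Int.units_ne_iff_eq_neg.1 e

lemma signDiff_congr {n : ℕ} (q : (Fin n → ℤˣ) → ℝ) (j : Fin n) {x y : Fin n → ℤˣ}
    (h : PrefixEq (j.val + 1) x y) : signDiff q j x = signDiff q j y := by
  simp only [signDiff, prefixMass_congr q h, h j (Nat.lt_succ_self _),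
      prefixMass_congr q (h.mono (Nat.le_succ _))]

/-- The martingale property: the conditional probability cancels the denominator, leaving the
weights `1/2` and `-1/2` on the two values of `y_j`. -/
lemma sum_mul_signDiff_eq_zero {n : ℕ} {q : (Fin n → ℤˣ) → ℝ} (hq : ∀ y, 0 < q y) (j : Fin n)
    (b : (Fin n → ℤˣ) → ℝ) (hb : ∀ x y, PrefixEq j.val x y → b x = b y) :
    ∑ y, q y * (b y * signDiff q j y) = 0 := by
  have := sum_div_prefixMass_eq_zero hq j
    (fun y => b y * (((y j : ℤ) : ℝ) * prefixMass q j.val y / 2)) ?_ ?_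
  · rw [← this]
    refine Finset.sum_congr rfl fun y _ => ?_
    have h2 := (prefixMass_pos (k := j.val + 1) hq y).ne'
    simp only [signDiff]
    field_simp
  · intro x y h
    have h' := h.mono (Nat.le_succ j.val)
    simp only [hb x y h', prefixMass_congr q h', h j (Nat.lt_succ_self _)]
  · intro y
    have h' := prefixEq_flipAt (le_refl j.val) y
    simp only [hb _ y h', prefixMass_congr q h', flipAt_same]
    push_cast
    ring

/-- Predictable multiples of the martingale differences `signDiff` are orthogonal. -/
lemma sum_signDiff_mul_signDiff_eq_zero {n : ℕ} {q : (Fin n → ℤˣ) → ℝ} (hq : ∀ y, 0 < q y)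
    (b : Fin n → (Fin n → ℤˣ) → ℝ) (hb : ∀ j x y, PrefixEq j.val x y → b j x = b j y)
    {i j : Fin n} (hij : i ≠ j) :
    ∑ y, q y * ((b i y * signDiff q i y) * (b j y * signDiff q j y)) = 0 := by
  have key : ∀ i j : Fin n, i < j →
      ∑ y, q y * ((b i y * signDiff q i y) * (b j y * signDiff q j y)) = 0 := by
    intro i j h
    rw [← sum_mul_signDiff_eq_zero hq j (fun y => b i y * signDiff q i y * b j y)]
    · exact Finset.sum_congr rfl fun y _ => by ring
    · intro x y hxy
      simp only [hb j x y hxy, hb i x y (hxy.mono (le_of_lt h)), signDiff_congr q i (hxy.mono h)]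
  rcases lt_or_gt_of_ne hij with h | h
  · exact key i j h
  · rw [← key j i h]
    exact Finset.sum_congr rfl fun y _ => by ring

/-! ### Bessel's inequality. -/

/-- Bessel's inequality for a bounded orthogonal family, in `ℓ¹` form. -/
lemma sum_norm_sum_le_of_orthogonal {ι α : Type*} [Fintype ι] [DecidableEq ι] [Fintype α]
    {q : α → ℝ} (hq : ∀ y, 0 ≤ q y) (hq1 : ∑ y, q y = 1) {v : ι → α → ℝ} {C : ℝ} (hC : 0 ≤ C)
    (hv : ∀ i y, |v i y| ≤ C) (horth : ∀ i j, i ≠ j → ∑ y, q y * (v i y * v j y) = 0)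
    {h : α → ℂ} (hh : ∀ y, ‖h y‖ ≤ 1) :
    ∑ i, ‖∑ y, ((q y * v i y : ℝ) : ℂ) * h y‖ ≤ √(Fintype.card ι) * C := by
  have real_case : ∀ f : α → ℝ, ∑ i, (∑ y, q y * v i y * f y) ^ 2 ≤ C ^ 2 * ∑ y, q y * f y ^ 2 := by
    intro f
    set c : ι → ℝ := fun i => ∑ y, q y * v i y * f y with hc
    have hS : ∑ y, q y * (∑ i, c i * v i y) ^ 2 ≤ C ^ 2 * ∑ i, c i ^ 2 := by
      calc ∑ y, q y * (∑ i, c i * v i y) ^ 2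
          = ∑ i, ∑ j, c i * c j * ∑ y, q y * (v i y * v j y) := by
            simp_rw [pow_two, Finset.sum_mul_sum, Finset.mul_sum]
            rw [Finset.sum_comm]
            refine Finset.sum_congr rfl fun i _ => ?_
            rw [Finset.sum_comm]
            exact Finset.sum_congr rfl fun j _ => Finset.sum_congr rfl fun y _ => by ring
        _ = ∑ i, c i ^ 2 * ∑ y, q y * (v i y * v i y) := by
            refine Finset.sum_congr rfl fun i _ => ?_
            rw [Finset.sum_eq_single i]
            · ring
            · intro j _ hj
              rw [horth i j hj.symm, mul_zero]
            · simp
        _ ≤ ∑ i, c i ^ 2 * C ^ 2 := by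
            refine Finset.sum_le_sum fun i _ => mul_le_mul_of_nonneg_left ?_ (sq_nonneg _)
            calc ∑ y, q y * (v i y * v i y) ≤ ∑ y, q y * C ^ 2 := by
                  refine Finset.sum_le_sum fun y _ => mul_le_mul_of_nonneg_left ?_ (hq y)
                  rw [← pow_two, ← sq_abs]
                  exact pow_le_pow_left₀ (abs_nonneg _) (hv i y) 2
              _ = C ^ 2 := by rw [← Finset.sum_mul, hq1, one_mul]
        _ = C ^ 2 * ∑ i, c i ^ 2 := by rw [← Finset.sum_mul, mul_comm]
    have hcross : ∑ i, c i ^ 2 = ∑ y, q y * (∑ i, c i * v i y) * f y := by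
      calc ∑ i, c i ^ 2 = ∑ i, ∑ y, c i * (q y * v i y * f y) := by
            refine Finset.sum_congr rfl fun i _ => ?_
            rw [← Finset.mul_sum, pow_two]
        _ = _ := by
            rw [Finset.sum_comm]
            refine Finset.sum_congr rfl fun y _ => ?_
            rw [Finset.mul_sum, Finset.sum_mul]
            exact Finset.sum_congr rfl fun i _ => by ring
    -- The factor `C ^ 2` on `f` makes normalisation of the `v i` unnecessary: expanding the square
    -- and using `hS` gives `C ^ 2` times the claim, so `C = 0` is treated apart.
    have hpos : 0 ≤ ∑ y, q y * (C ^ 2 * f y - ∑ i, c i * v i y) ^ 2 :=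
      Finset.sum_nonneg fun y _ => mul_nonneg (hq y) (sq_nonneg _)
    have hexp : ∑ y, q y * (C ^ 2 * f y - ∑ i, c i * v i y) ^ 2
        = C ^ 4 * ∑ y, q y * f y ^ 2 - 2 * C ^ 2 * ∑ i, c i ^ 2
          + ∑ y, q y * (∑ i, c i * v i y) ^ 2 := by
      rw [hcross, Finset.mul_sum, Finset.mul_sum, ← Finset.sum_sub_distrib,
        ← Finset.sum_add_distrib]
      exact Finset.sum_congr rfl fun y _ => by ring
    rcases hC.eq_or_lt with h0 | h0
    · have : ∀ i y, v i y = 0 := fun i y => by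
        have := hv i y
        rw [← h0] at this
        exact abs_nonpos_iff.1 this
      simp [this, ← h0]
    · have : 0 < C ^ 2 := by positivity
      have h3 : 0 ≤ C ^ 2 * (C ^ 2 * ∑ y, q y * f y ^ 2 - ∑ i, c i ^ 2) := by nlinarith
      have := nonneg_of_mul_nonneg_right h3 this
      linarith
  set g : ι → ℂ := fun i => ∑ y, ((q y * v i y : ℝ) : ℂ) * h y with hg
  -- The `v i` are real, so the real and imaginary parts of `h` separate.
  have hsq : ∑ i, ‖g i‖ ^ 2 ≤ C ^ 2 := by
    have e : ∀ i, ‖g i‖ ^ 2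
        = (∑ y, q y * v i y * (h y).re) ^ 2 + (∑ y, q y * v i y * (h y).im) ^ 2 := by
      intro i
      rw [← Complex.normSq_eq_norm_sq, Complex.normSq_apply]
      simp only [hg, Complex.re_sum, Complex.im_sum, Complex.re_ofReal_mul, Complex.im_ofReal_mul]
      ring
    calc ∑ i, ‖g i‖ ^ 2 ≤ C ^ 2 * ∑ y, q y * (h y).re ^ 2 + C ^ 2 * ∑ y, q y * (h y).im ^ 2 := by
          simp only [e, Finset.sum_add_distrib]
          exact add_le_add (real_case _) (real_case _)
      _ = C ^ 2 * ∑ y, q y * ‖h y‖ ^ 2 := by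
          rw [← mul_add, ← Finset.sum_add_distrib]
          congr 1
          refine Finset.sum_congr rfl fun y _ => ?_
          rw [← Complex.normSq_eq_norm_sq, Complex.normSq_apply]
          ring
      _ ≤ C ^ 2 * ∑ y, q y := by
          refine mul_le_mul_of_nonneg_left (Finset.sum_le_sum fun y _ => ?_) (sq_nonneg _)
          exact mul_le_of_le_one_right (hq y) (pow_le_one₀ (norm_nonneg _) (hh y))
      _ = C ^ 2 := by rw [hq1, mul_one]
  have hcs := sq_sum_le_card_mul_sum_sq (s := Finset.univ) (f := fun i => ‖g i‖)
  rw [← Real.sqrt_sq hC, ← Real.sqrt_mul (Nat.cast_nonneg _)]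
  refine Real.le_sqrt_of_sq_le (hcs.trans ?_)
  rw [Finset.card_univ]
  exact mul_le_mul_of_nonneg_left hsq (Nat.cast_nonneg _)

/-! ### Decay of the characteristic function. -/

/-- The character `exp (i t ⟨x, y⟩)`. -/
noncomputable def innerChar {n : ℕ} (t : ℝ) (x y : Fin n → ℤˣ) : ℂ :=
  Complex.exp (((t * (signInner x y : ℝ) : ℝ) : ℂ) * Complex.I)

lemma norm_innerChar {n : ℕ} (t : ℝ) (x y : Fin n → ℤˣ) : ‖innerChar t x y‖ = 1 :=
  Complex.norm_exp_ofReal_mul_I _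

lemma innerChar_flipAt {n : ℕ} (t : ℝ) (i : Fin n) (x y : Fin n → ℤˣ) :
    innerChar t (flipAt i x) y = innerChar t x y *
      ((Real.cos (2 * t) : ℂ) -
        ((((x i : ℤ) : ℝ) * ((y i : ℤ) : ℝ) * Real.sin (2 * t) : ℝ) : ℂ) * Complex.I) := by
  have : ((t * (signInner (flipAt i x) y : ℝ) : ℝ) : ℂ) * Complex.I
      = ((t * (signInner x y : ℝ) : ℝ) : ℂ) * Complex.I
        + ((-(((x i : ℤ) : ℝ) * ((y i : ℤ) : ℝ) * (2 * t)) : ℝ) : ℂ) * Complex.I := by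
    rw [signInner_flipAt]
    push_cast
    ring
  rw [innerChar, this, Complex.exp_add, ← innerChar, Complex.exp_mul_I, ← Complex.ofReal_cos,
    ← Complex.ofReal_sin]
  congr 1
  rcases Int.units_eq_one_or (x i) with hx | hx <;>
    rcases Int.units_eq_one_or (y i) with hy | hy <;> simp [hx, hy, sub_eq_add_neg]

/-- Decay of the characteristic function of the inner product of two independent vectors whose
mass functions change by a factor at most `C` under a flip of one coordinate. -/
theorem norm_sum_innerChar_le {n : ℕ} {p q : (Fin n → ℤˣ) → ℝ} (hp : ∀ x, 0 ≤ p x)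
    (hp1 : ∑ x, p x = 1) (hq : ∀ y, 0 < q y) (hq1 : ∑ y, q y = 1) {C : ℝ} (hC : 1 ≤ C)
    (hpC : ∀ i x, p (flipAt i x) ≤ C * p x) (hqC : ∀ i y, q (flipAt i y) ≤ C * q y) (t : ℝ) :
    ‖∑ x, ∑ y, ((p x * q y : ℝ) : ℂ) * innerChar t x y‖ * (√n * |Real.sin (2 * t)|)
      ≤ 3 * C ^ 2 := by
  have hC0 : 0 ≤ C := by linarith
  set G : (Fin n → ℤˣ) → ℂ := fun x => ∑ y, (q y : ℂ) * innerChar t x y with hG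
  set g : Fin n → (Fin n → ℤˣ) → ℂ :=
    fun i x => ∑ y, ((q y * signDiff q i y : ℝ) : ℂ) * innerChar t x y with hg
  set k : Fin n → (Fin n → ℤˣ) → ℂ := fun i x =>
    ∑ y, ((q y * (prefixMean q i y * signDiff q i y) : ℝ) : ℂ) * innerChar t x y with hk
  have hgsum : ∀ x, ∑ i, ‖g i x‖ ≤ √n * C := by
    intro x
    have := sum_norm_sum_le_of_orthogonal (v := fun i => signDiff q i) (fun y => (hq y).le) hq1
      hC0 (fun i y => abs_signDiff_le hq hC i (hqC i) y)
      (fun i j hij => by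
        simpa using sum_signDiff_mul_signDiff_eq_zero hq (fun _ _ => 1) (fun _ _ _ _ => rfl) hij)
      (h := innerChar t x) (fun y => (norm_innerChar t x y).le)
    rwa [Fintype.card_fin] at this
  have hksum : ∀ x, ∑ i, ‖k i x‖ ≤ √n * C := by
    intro x
    have := sum_norm_sum_le_of_orthogonal (v := fun i y => prefixMean q i y * signDiff q i y)
      (fun y => (hq y).le) hq1 hC0
      (fun i y => by
        rw [abs_mul]
        exact (mul_le_of_le_one_left (abs_nonneg _) (abs_prefixMean_le hq i y)).trans
          (abs_signDiff_le hq hC i (hqC i) y))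
      (fun i j hij => sum_signDiff_mul_signDiff_eq_zero hq (prefixMean q)
        (fun j x y h => prefixMean_congr q j h) hij)
      (h := innerChar t x) (fun y => (norm_innerChar t x y).le)
    rwa [Fintype.card_fin] at this
  -- The factor `y i` produced by the flip meets `signDiff q i y`; `sign_mul_signDiff` turns the
  -- product into a constant, which makes `G x` appear.
  have hrec : ∀ i x, g i (flipAt i x) = (Real.cos (2 * t) : ℂ) * g i x
      - ((((x i : ℤ) : ℝ) * Real.sin (2 * t) : ℝ) : ℂ) * Complex.I * (G x - k i x) := by
    intro i x
    simp only [hg, hG, hk, Finset.mul_sum, ← Finset.sum_sub_distrib]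
    refine Finset.sum_congr rfl fun y _ => ?_
    have hs := congrArg (fun r : ℝ => (r : ℂ)) (sign_mul_signDiff hq i y)
    simp only [innerChar_flipAt]
    push_cast at hs ⊢
    linear_combination (-(q y : ℂ) * (x i : ℤ) * Complex.sin (2 * t) * Complex.I *
      innerChar t x y) * hs
  have hpt : ∀ i x, |Real.sin (2 * t)| * ‖G x‖
      ≤ ‖g i (flipAt i x)‖ + ‖g i x‖ + ‖k i x‖ := by
    intro i x
    have hs : ‖((((x i : ℤ) : ℝ) * Real.sin (2 * t) : ℝ) : ℂ) * Complex.I‖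
        = |Real.sin (2 * t)| := by
      rw [norm_mul, Complex.norm_I, mul_one, Complex.norm_real, Real.norm_eq_abs, abs_mul,
        abs_units_cast, one_mul]
    have hc : ‖(Real.cos (2 * t) : ℂ)‖ ≤ 1 := by
      rw [Complex.norm_real]; exact Real.abs_cos_le_one _
    have e : ((((x i : ℤ) : ℝ) * Real.sin (2 * t) : ℝ) : ℂ) * Complex.I * G x
        = (Real.cos (2 * t) : ℂ) * g i x - g i (flipAt i x)
          + ((((x i : ℤ) : ℝ) * Real.sin (2 * t) : ℝ) : ℂ) * Complex.I * k i x := by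
      rw [hrec]; ring
    calc |Real.sin (2 * t)| * ‖G x‖
        = ‖((((x i : ℤ) : ℝ) * Real.sin (2 * t) : ℝ) : ℂ) * Complex.I * G x‖ := by
          rw [norm_mul, hs]
      _ ≤ ‖(Real.cos (2 * t) : ℂ) * g i x‖ + ‖g i (flipAt i x)‖
          + ‖((((x i : ℤ) : ℝ) * Real.sin (2 * t) : ℝ) : ℂ) * Complex.I * k i x‖ := by
          rw [e]
          exact (norm_add_le _ _).trans (add_le_add_left (norm_sub_le _ _) _)
      _ ≤ ‖g i x‖ + ‖g i (flipAt i x)‖ + ‖k i x‖ := by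
          rw [norm_mul _ (g i x), norm_mul _ (k i x), hs]
          have h1 := mul_le_of_le_one_left (norm_nonneg (g i x)) hc
          have h2 := mul_le_of_le_one_left (norm_nonneg (k i x)) (Real.abs_sin_le_one (2 * t))
          linarith
      _ = _ := by ring
  -- The only use of the ratio bound on `p`.
  have hflip : ∀ i, ∑ x, p x * ‖g i (flipAt i x)‖ ≤ C * ∑ x, p x * ‖g i x‖ := by
    intro i
    rw [← sum_flipAt i, Finset.mul_sum]
    refine Finset.sum_le_sum fun x _ => ?_
    rw [flipAt_flipAt, ← mul_assoc]
    exact mul_le_mul_of_nonneg_right (hpC i x) (norm_nonneg _)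
  have havg : ∀ f : Fin n → (Fin n → ℤˣ) → ℂ, (∀ x, ∑ i, ‖f i x‖ ≤ √n * C) →
      ∑ i, ∑ x, p x * ‖f i x‖ ≤ √n * C := by
    intro f hf
    rw [Finset.sum_comm]
    calc ∑ x, ∑ i, p x * ‖f i x‖ ≤ ∑ x, p x * (√n * C) := by
          refine Finset.sum_le_sum fun x _ => ?_
          rw [← Finset.mul_sum]
          exact mul_le_mul_of_nonneg_left (hf x) (hp x)
      _ = √n * C := by rw [← Finset.sum_mul, hp1, one_mul]
  set B := ∑ x, p x * ‖G x‖ with hB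
  have htot : n * (|Real.sin (2 * t)| * B) ≤ (C + 2) * (√n * C) := by
    calc n * (|Real.sin (2 * t)| * B) = ∑ i : Fin n, ∑ x, p x * (|Real.sin (2 * t)| * ‖G x‖) := by
          rw [Finset.sum_const, Finset.card_univ, Fintype.card_fin, nsmul_eq_mul, hB,
            Finset.mul_sum]
          congr 1
          exact Finset.sum_congr rfl fun x _ => by ring
      _ ≤ ∑ i : Fin n, (∑ x, p x * ‖g i (flipAt i x)‖ + ∑ x, p x * ‖g i x‖
            + ∑ x, p x * ‖k i x‖) := by
          refine Finset.sum_le_sum fun i _ => ?_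
          rw [← Finset.sum_add_distrib, ← Finset.sum_add_distrib]
          refine Finset.sum_le_sum fun x _ => ?_
          rw [← mul_add, ← mul_add]
          exact mul_le_mul_of_nonneg_left (hpt i x) (hp x)
      _ ≤ ∑ i : Fin n, (C * ∑ x, p x * ‖g i x‖ + ∑ x, p x * ‖g i x‖
            + ∑ x, p x * ‖k i x‖) :=
          Finset.sum_le_sum fun i _ => by linarith [hflip i]
      _ = (C + 1) * (∑ i, ∑ x, p x * ‖g i x‖) + ∑ i, ∑ x, p x * ‖k i x‖ := by
          rw [Finset.sum_add_distrib, Finset.sum_add_distrib, ← Finset.mul_sum]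
          ring
      _ ≤ (C + 1) * (√n * C) + √n * C := by
          have h1 := mul_le_mul_of_nonneg_left (havg g hgsum) (show 0 ≤ C + 1 by linarith)
          have h2 := havg k hksum
          linarith
      _ = (C + 2) * (√n * C) := by ring
  have hBle : ‖∑ x, ∑ y, ((p x * q y : ℝ) : ℂ) * innerChar t x y‖ ≤ B := by
    refine (norm_sum_le _ _).trans (Finset.sum_le_sum fun x _ => le_of_eq ?_)
    have hpx : p x = ‖(p x : ℂ)‖ := by rw [Complex.norm_real, Real.norm_of_nonneg (hp x)]
    rw [show p x * ‖G x‖ = ‖(p x : ℂ) * G x‖ by rw [norm_mul, ← hpx], Finset.mul_sum]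
    congr 1
    refine Finset.sum_congr rfl fun y _ => ?_
    push_cast
    ring
  rcases Nat.eq_zero_or_pos n with h0 | h0
  · subst h0
    simp
    positivity
  · have hs : 0 < √(n : ℝ) := Real.sqrt_pos.2 (Nat.cast_pos.2 h0)
    have hB' : B * (√n * |Real.sin (2 * t)|) ≤ (C + 2) * C := by
      refine le_of_mul_le_mul_left ?_ hs
      have hn : (n : ℝ) = √n * √n := (Real.mul_self_sqrt (Nat.cast_nonneg _)).symm
      calc √n * (B * (√n * |Real.sin (2 * t)|)) = n * (|Real.sin (2 * t)| * B) := by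
            nth_rewrite 3 [hn]; ring
        _ ≤ √n * ((C + 2) * C) := htot.trans_eq (by ring)
    refine (mul_le_mul_of_nonneg_right hBle (by positivity)).trans (hB'.trans ?_)
    nlinarith

/-! ### Fourier inversion modulo `m` and cosecant sums. -/

/-- The sum of the additive characters modulo `m` detects divisibility by `m`. -/
lemma sum_range_exp_eq_ite {m : ℕ} (hm : m ≠ 0) (d : ℤ) :
    ∑ j ∈ Finset.range m, Complex.exp (((2 * Real.pi * j / m * (d : ℝ) : ℝ) : ℂ) * Complex.I)
      = if (m : ℤ) ∣ d then (m : ℂ) else 0 := by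
  have hζ := Complex.isPrimitiveRoot_exp m hm
  set ζ := Complex.exp (2 * Real.pi * Complex.I / m) with hζdef
  have e : ∀ j : ℕ, Complex.exp (((2 * Real.pi * j / m * (d : ℝ) : ℝ) : ℂ) * Complex.I)
      = (ζ ^ d) ^ j := by
    intro j
    rw [hζdef, ← Complex.exp_int_mul, ← Complex.exp_nat_mul]
    congr 1
    push_cast
    ring
  simp only [e]
  split_ifs with h
  · rw [(hζ.zpow_eq_one_iff_dvd d).2 h]
    simp
  · have hne : ζ ^ d ≠ 1 := fun h' => h ((hζ.zpow_eq_one_iff_dvd d).1 h')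
    have h1 : (ζ ^ d) ^ m = 1 := by
      rw [← zpow_natCast, ← zpow_mul, mul_comm, zpow_mul, zpow_natCast, hζ.pow_eq_one, one_zpow]
    rw [geom_sum_eq hne, h1]
    simp

/-- The mass of a residue class is bounded by the average of the characteristic function over
the additive characters modulo `m`. -/
lemma sum_dvd_sub_le {α : Type*} [Fintype α] {m : ℕ} (hm : m ≠ 0) (r : α → ℝ) (S : α → ℤ)
    (z : ℤ) :
    ∑ a, (if (m : ℤ) ∣ S a - z then r a else 0) ≤
      (∑ j ∈ Finset.range m,
        ‖∑ a, (r a : ℂ) * Complex.exp (((2 * Real.pi * j / m * (S a : ℝ) : ℝ) : ℂ) *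
          Complex.I)‖) / m := by
  have hm' : (0 : ℝ) < m := Nat.cast_pos.2 (Nat.pos_of_ne_zero hm)
  rw [le_div_iff₀ hm']
  have e : (((∑ a, (if (m : ℤ) ∣ S a - z then r a else 0)) * m : ℝ) : ℂ)
      = ∑ j ∈ Finset.range m,
        Complex.exp (((-(2 * Real.pi * j / m * (z : ℝ)) : ℝ) : ℂ) * Complex.I) *
        ∑ a, (r a : ℂ) * Complex.exp (((2 * Real.pi * j / m * (S a : ℝ) : ℝ) : ℂ) *
          Complex.I) := by
    simp only [Finset.mul_sum]
    rw [Finset.sum_comm, Finset.sum_mul, Complex.ofReal_sum]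
    refine Finset.sum_congr rfl fun a _ => ?_
    have h1 : ((((if (m : ℤ) ∣ S a - z then r a else 0) * m : ℝ)) : ℂ)
        = r a * (if (m : ℤ) ∣ S a - z then (m : ℂ) else 0) := by
      split_ifs <;> simp
    rw [h1, ← sum_range_exp_eq_ite hm, Finset.mul_sum]
    refine Finset.sum_congr rfl fun j _ => ?_
    rw [mul_left_comm, ← Complex.exp_add]
    congr 2
    push_cast
    ring
  calc (∑ a, (if (m : ℤ) ∣ S a - z then r a else 0)) * (m : ℝ)
      ≤ ‖(((∑ a, (if (m : ℤ) ∣ S a - z then r a else 0)) * m : ℝ) : ℂ)‖ := by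
        rw [Complex.norm_real]; exact le_abs_self _
    _ ≤ _ := by
        rw [e]
        refine (norm_sum_le _ _).trans (Finset.sum_le_sum fun j _ => ?_)
        rw [norm_mul, Complex.norm_exp_ofReal_mul_I, one_mul]

/-- Jordan's inequality on `[0, 1/2]`, reflected about `1/2`. The product form gives a reciprocal
that splits into partial fractions, hence into harmonic sums. -/
lemma two_mul_mul_one_sub_le_sin {x : ℝ} (h0 : 0 ≤ x) (h1 : x ≤ 1) :
    2 * x * (1 - x) ≤ Real.sin (Real.pi * x) := by
  have key : ∀ x : ℝ, 0 ≤ x → x ≤ 1 / 2 → 2 * x * (1 - x) ≤ Real.sin (Real.pi * x) := by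
    intro x h0 h1
    have h := Real.mul_le_sin (x := Real.pi * x) (by positivity) (by nlinarith [Real.pi_pos])
    have e : 2 / Real.pi * (Real.pi * x) = 2 * x := by
      have := Real.pi_ne_zero
      field_simp
    nlinarith
  rcases le_total x (1 / 2) with h | h
  · exact key x h0 h
  · have := key (1 - x) (by linarith) (by linarith)
    rw [show Real.pi * (1 - x) = Real.pi - Real.pi * x by ring, Real.sin_pi_sub] at this
    linarith

lemma sum_inv_sin_le (l : ℕ) :
    ∑ k ∈ Finset.range l, (Real.sin (Real.pi * ((k + 1 : ℕ) : ℝ) / (l + 1 : ℕ)))⁻¹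
      ≤ (l + 1 : ℕ) * ∑ k ∈ Finset.range l, ((k : ℝ) + 1)⁻¹ := by
  have hrefl : ∑ k ∈ Finset.range l, ((l : ℝ) - k)⁻¹ = ∑ k ∈ Finset.range l, ((k : ℝ) + 1)⁻¹ := by
    rw [← Finset.sum_range_reflect]
    refine Finset.sum_congr rfl fun k hk => ?_
    have hk' := Finset.mem_range.1 hk
    rw [Nat.sub_sub, Nat.cast_sub (by omega)]
    push_cast
    congr 1
    ring
  calc _ ≤ ∑ k ∈ Finset.range l, ((l + 1 : ℕ) : ℝ) / 2 * (((k : ℝ) + 1)⁻¹ + ((l : ℝ) - k)⁻¹) := by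
        refine Finset.sum_le_sum fun k hk => ?_
        have hk' : (k : ℝ) + 1 ≤ l := by exact_mod_cast Finset.mem_range.1 hk
        have hk0 : (0 : ℝ) ≤ k := Nat.cast_nonneg k
        have hl : (0 : ℝ) < (l : ℝ) + 1 := by linarith
        have h1 : (0 : ℝ) < (k : ℝ) + 1 := by linarith
        have h2 : (0 : ℝ) < (l : ℝ) - k := by linarith
        have h := two_mul_mul_one_sub_le_sin (x := ((k : ℝ) + 1) / (l + 1)) (by positivity)
          (by rw [div_le_one hl]; linarith)
        have e1 : (2 * (((k : ℝ) + 1) / (l + 1)) * (1 - ((k : ℝ) + 1) / (l + 1)))⁻¹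
            = ((l : ℝ) + 1) / 2 * (((k : ℝ) + 1)⁻¹ + ((l : ℝ) - k)⁻¹) := by
          have e2 : 1 - ((k : ℝ) + 1) / (l + 1) = ((l : ℝ) - k) / (l + 1) := by
            field_simp
            ring
          rw [e2]
          field_simp
          ring
        have hpos : 0 < 2 * (((k : ℝ) + 1) / (l + 1)) * (1 - ((k : ℝ) + 1) / (l + 1)) := by
          have : ((k : ℝ) + 1) / (l + 1) < 1 := by rw [div_lt_one hl]; linarith
          have : 0 < 1 - ((k : ℝ) + 1) / (l + 1) := by linarith
          positivity
        push_cast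
        rw [← e1, mul_div_assoc]
        exact inv_anti₀ hpos h
    _ = _ := by
        rw [← Finset.mul_sum, Finset.sum_add_distrib, hrefl]
        ring

lemma sum_range_inv_le {l : ℕ} {N : ℝ} (hl : l ≤ N) (hN : 1 ≤ N) :
    ∑ k ∈ Finset.range l, ((k : ℝ) + 1)⁻¹ ≤ 1 + Real.log N := by
  have h := harmonic_le_one_add_log l
  have e : ((harmonic l : ℚ) : ℝ) = ∑ k ∈ Finset.range l, ((k : ℝ) + 1)⁻¹ := by
    simp [harmonic]
  rw [← e]
  refine h.trans (add_le_add_right ?_ _)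
  rcases Nat.eq_zero_or_pos l with h0 | h0
  · subst h0; simpa using Real.log_nonneg hN
  · exact Real.log_le_log (Nat.cast_pos.2 h0) hl

/-- A sum over multiples of `4` of a nonnegative function of period `m`. -/
lemma sum_range_four_mul_le {f : ℕ → ℝ} (hf : ∀ k, 0 ≤ f k) {m : ℕ}
    (hper : ∀ k, f (m + k) = f k) :
    ∑ j ∈ Finset.range m, f (4 * j) ≤ 4 * ∑ k ∈ Finset.range m, f k := by
  -- The points `4 * j` with `j < m` are distinct and lie in four periods.
  have h4 : ∑ k ∈ Finset.range (m + (m + (m + m))), f k = 4 * ∑ k ∈ Finset.range m, f k := by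
    simp only [Finset.sum_range_add, hper]
    ring
  rw [← h4, ← Finset.sum_image (f := f) (g := fun j => 4 * j) (s := Finset.range m)
    (fun a _ b _ h => by simpa using h)]
  refine Finset.sum_le_sum_of_subset_of_nonneg ?_ fun k _ _ => hf k
  intro k hk
  obtain ⟨j, hj, rfl⟩ := Finset.mem_image.1 hk
  have := Finset.mem_range.1 hj
  exact Finset.mem_range.2 (by omega)

/-- Use the trivial bound `1` where the sine vanishes and `K / |sin|` elsewhere. This majorant has
period `m`; in one period only `k = 0` is degenerate, and the rest is a cosecant sum. -/
lemma sum_min_inv_sin_le {K : ℝ} (hK : 0 ≤ K) {m : ℕ} (hm : m ≠ 0) {N : ℝ} (hmN : m ≤ N + 1)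
    (hN : 1 ≤ N) {a : ℕ → ℝ} (ha1 : ∀ j, a j ≤ 1)
    (ha : ∀ j : ℕ, a j * |Real.sin (Real.pi * ((4 * j : ℕ) : ℝ) / m)| ≤ K) :
    ∑ j ∈ Finset.range m, a j ≤ 4 * (1 + K * m * (1 + Real.log N)) := by
  obtain ⟨l, rfl⟩ := Nat.exists_eq_succ_of_ne_zero hm
  set s : ℕ → ℝ := fun k => |Real.sin (Real.pi * (k : ℝ) / (l + 1 : ℕ))| with hs
  set f : ℕ → ℝ := fun k => if s k = 0 then 1 else K * (s k)⁻¹ with hf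
  have hs0 : ∀ k, 0 ≤ s k := fun k => abs_nonneg _
  have hf0 : ∀ k, 0 ≤ f k := by
    intro k
    simp only [hf]
    split_ifs
    · exact zero_le_one
    · exact mul_nonneg hK (inv_nonneg.2 (hs0 k))
  have hper : ∀ k, f (l + 1 + k) = f k := by
    intro k
    have : s (l + 1 + k) = s k := by
      have hl : ((l + 1 : ℕ) : ℝ) ≠ 0 := Nat.cast_ne_zero.2 (Nat.succ_ne_zero l)
      simp only [hs]
      rw [Nat.cast_add (l + 1) k, show Real.pi * (((l + 1 : ℕ) : ℝ) + k) / (l + 1 : ℕ)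
        = Real.pi * (k : ℝ) / (l + 1 : ℕ) + Real.pi by field_simp; ring, Real.sin_add_pi, abs_neg]
    simp only [hf, this]
  have haf : ∀ j, a j ≤ f (4 * j) := by
    intro j
    simp only [hf]
    split_ifs with h
    · exact ha1 j
    · rw [← div_eq_mul_inv, le_div_iff₀ (lt_of_le_of_ne (hs0 _) (Ne.symm h))]
      exact ha j
  have hsum : ∑ k ∈ Finset.range (l + 1), f k ≤ 1 + K * (l + 1 : ℕ) * (1 + Real.log N) := by
    rw [Finset.sum_range_succ']
    have h0 : f 0 = 1 := by simp [hf, hs]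
    have h1 : ∑ k ∈ Finset.range l, f (k + 1)
        = K * ∑ k ∈ Finset.range l,
          (Real.sin (Real.pi * ((k + 1 : ℕ) : ℝ) / (l + 1 : ℕ)))⁻¹ := by
      rw [Finset.mul_sum]
      refine Finset.sum_congr rfl fun k hk => ?_
      have hk' : ((k + 1 : ℕ) : ℝ) < (l + 1 : ℕ) :=
        Nat.cast_lt.2 (Nat.succ_lt_succ (Finset.mem_range.1 hk))
      have hl : (0 : ℝ) < (l + 1 : ℕ) := Nat.cast_pos.2 (Nat.succ_pos l)
      have hk0 : (0 : ℝ) < (k + 1 : ℕ) := Nat.cast_pos.2 (Nat.succ_pos k)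
      have hpos : 0 < Real.sin (Real.pi * ((k + 1 : ℕ) : ℝ) / (l + 1 : ℕ)) := by
        refine Real.sin_pos_of_pos_of_lt_pi (by have := Real.pi_pos; positivity) ?_
        rw [div_lt_iff₀ hl]
        exact mul_lt_mul_of_pos_left hk' Real.pi_pos
      have hsk : s (k + 1) = Real.sin (Real.pi * ((k + 1 : ℕ) : ℝ) / (l + 1 : ℕ)) :=
        abs_of_pos hpos
      simp only [hf]
      rw [hsk, if_neg hpos.ne']
    have h2 := sum_inv_sin_le l
    have h3 := sum_range_inv_le (l := l) (N := N) (by push_cast at hmN; linarith) hN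
    have h4 := mul_le_mul_of_nonneg_left
      (h2.trans (mul_le_mul_of_nonneg_left h3 (Nat.cast_nonneg (l + 1)))) hK
    rw [h0, h1]
    linarith
  calc ∑ j ∈ Finset.range (l + 1), a j ≤ ∑ j ∈ Finset.range (l + 1), f (4 * j) :=
        Finset.sum_le_sum fun j _ => haf j
    _ ≤ 4 * ∑ k ∈ Finset.range (l + 1), f k := sum_range_four_mul_le hf0 hper
    _ ≤ _ := by linarith

/-- The inner product of two independent vectors, whose mass functions change by a factor at most
`C` under a flip of one coordinate, is spread over the residue classes modulo `m ≈ √n`. -/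
theorem sum_signInner_dvd_le {n : ℕ} (hn : 2 ≤ n) {p q : (Fin n → ℤˣ) → ℝ} (hp : ∀ x, 0 ≤ p x)
    (hp1 : ∑ x, p x = 1) (hq : ∀ y, 0 < q y) (hq1 : ∑ y, q y = 1) {C : ℝ} (hC : 1 ≤ C)
    (hpC : ∀ i x, p (flipAt i x) ≤ C * p x) (hqC : ∀ i y, q (flipAt i y) ≤ C * q y)
    {m : ℕ} (hm : √n ≤ m) (hm' : m ≤ √n + 1) (z : ℤ) :
    ∑ a : (Fin n → ℤˣ) × (Fin n → ℤˣ),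
        (if (m : ℤ) ∣ signInner a.1 a.2 - z then p a.1 * q a.2 else 0)
      ≤ 28 * C ^ 2 * Real.logb 2 n / √n := by
  have hn2 : (2 : ℝ) ≤ n := by exact_mod_cast hn
  have hs1 : 1 ≤ √(n : ℝ) := Real.one_le_sqrt.2 (by linarith)
  have hs0 : 0 < √(n : ℝ) := by linarith
  have hm0 : (0 : ℝ) < m := by linarith
  have hmne : m ≠ 0 := by rintro rfl; simp at hm0
  set φ : ℕ → ℝ := fun j => ‖∑ a : (Fin n → ℤˣ) × (Fin n → ℤˣ),
    ((p a.1 * q a.2 : ℝ) : ℂ) * innerChar (2 * Real.pi * j / m) a.1 a.2‖ with hφ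
  have hφ1 : ∀ j, φ j ≤ 1 := by
    intro j
    refine (norm_sum_le _ _).trans (le_of_eq ?_)
    have : ∀ a : (Fin n → ℤˣ) × (Fin n → ℤˣ),
        ‖((p a.1 * q a.2 : ℝ) : ℂ) * innerChar (2 * Real.pi * j / m) a.1 a.2‖
          = p a.1 * q a.2 := by
      intro a
      rw [norm_mul, norm_innerChar, mul_one, Complex.norm_real,
        Real.norm_of_nonneg (mul_nonneg (hp _) (hq _).le)]
    simp only [this]
    rw [Fintype.sum_prod_type]
    simp only [← Finset.mul_sum, hq1, mul_one, hp1]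
  have hφK : ∀ j : ℕ, φ j * |Real.sin (Real.pi * ((4 * j : ℕ) : ℝ) / m)| ≤ 3 * C ^ 2 / √n := by
    intro j
    have h := norm_sum_innerChar_le hp hp1 hq hq1 hC hpC hqC (2 * Real.pi * j / m)
    rw [← Fintype.sum_prod_type'
      (f := fun x y => ((p x * q y : ℝ) : ℂ) * innerChar (2 * Real.pi * j / m) x y)] at h
    rw [le_div_iff₀ hs0]
    refine le_trans (le_of_eq ?_) h
    -- The decay involves `sin 2t` with `t = 2πj/m`, hence the multiples of four.
    rw [show Real.pi * ((4 * j : ℕ) : ℝ) / m = 2 * (2 * Real.pi * j / m) by push_cast; ring]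
    simp only [hφ]
    ring
  have hL1 : 1 ≤ Real.logb 2 n := by
    rw [Real.le_logb_iff_rpow_le (by norm_num) (by linarith)]
    simpa using hn2
  have hlog : Real.log √n ≤ Real.logb 2 n := by
    have h2 := Real.log_two_lt_d9
    have h2' : 0 < Real.log 2 := Real.log_pos (by norm_num)
    have h3 : 0 ≤ Real.log n := Real.log_nonneg (by linarith)
    rw [Real.log_sqrt (by linarith), Real.logb, le_div_iff₀ h2']
    nlinarith
  have hsum := sum_min_inv_sin_le (K := 3 * C ^ 2 / √n) (by positivity) hmne hm' hs1 hφ1 hφK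
  have hres := sum_dvd_sub_le hmne (fun a : (Fin n → ℤˣ) × (Fin n → ℤˣ) => p a.1 * q a.2)
    (fun a => signInner a.1 a.2) z
  refine hres.trans ?_
  rw [div_le_iff₀ hm0]
  refine hsum.trans ?_
  set L := Real.logb 2 (n : ℝ)
  have hC2 : 1 ≤ C ^ 2 := one_le_pow₀ hC
  have h1 : 1 + Real.log √n ≤ 2 * L := by linarith
  have h2 : 3 * C ^ 2 / √n * m * (1 + Real.log √n) ≤ 3 * C ^ 2 / √n * m * (2 * L) :=
    mul_le_mul_of_nonneg_left h1 (by positivity)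
  -- Absorbs the additive `1` into the main term, giving `4 * (1 + 3 * 2) = 28`.
  have h3 : 1 ≤ C ^ 2 * L / √n * m := by
    have : 1 ≤ C ^ 2 * L := one_le_mul_of_one_le_of_one_le hC2 hL1
    rw [div_mul_eq_mul_div, le_div_iff₀ hs0, one_mul]
    nlinarith
  calc 4 * (1 + 3 * C ^ 2 / √n * m * (1 + Real.log √n))
      ≤ 4 * (C ^ 2 * L / √n * m + 3 * C ^ 2 / √n * m * (2 * L)) := by linarith
    _ = 28 * C ^ 2 * L / √n * m := by ring

/-! ### From random variables to mass functions. -/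

instance : MeasurableSingletonClass ℤˣ where
  measurableSet_singleton u := by
    have : ({u} : Set ℤˣ) = Units.val ⁻¹' {(u : ℤ)} := by
      ext v; simp [Units.ext_iff]
    rw [this]
    exact comap_measurable _ (measurableSet_singleton _)

lemma sum_measureReal_fiber {Ω β : Type*} [MeasurableSpace Ω] {μ : Measure Ω}
    [IsProbabilityMeasure μ] [Fintype β] [MeasurableSpace β] [MeasurableSingletonClass β]
    {X : Ω → β} (hX : Measurable X) : ∑ x, μ.real (X ⁻¹' {x}) = 1 := by
  rw [sum_measureReal_preimage_singleton _ fun y _ => hX (measurableSet_singleton y)]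
  simp

/-- The mass function of a strong Santha-Vazirani source changes by a bounded factor when one
coordinate is flipped. -/
lemma IsStrongSVSource.measureReal_flipAt_le {Ω : Type*} [MeasurableSpace Ω] {μ : Measure Ω}
    [IsProbabilityMeasure μ] {n : ℕ} {a : ℝ} (ha : 0 < a) {X : Ω → Fin n → ℤˣ}
    (hX : Measurable X) (h : IsStrongSVSource μ a X) (i : Fin n) (x : Fin n → ℤˣ) :
    μ.real (X ⁻¹' {flipAt i x}) ≤ 1 / a * μ.real (X ⁻¹' {x}) := by
  set E : Set Ω := {ω | ∀ j, j ≠ i → X ω j = x j} with hE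
  have hsub : X ⁻¹' {flipAt i x} ⊆ E := by
    intro ω hω j hj
    rw [show X ω = flipAt i x from hω, flipAt_of_ne hj]
  by_cases h0 : μ E = 0
  · rw [(measureReal_eq_zero_iff (by finiteness)).2 (measure_mono_null hsub h0)]
    positivity
  have hEm : MeasurableSet E :=
    hX (Set.toFinite {y : Fin n → ℤˣ | ∀ j, j ≠ i → y j = x j}).measurableSet
  have hmem := h i x h0
  have hcond : ∀ t, (μ[|E]).real t = (μ.real E)⁻¹ * μ.real (E ∩ t) := by
    intro t
    rw [measureReal_def, cond_apply hEm, ENNReal.toReal_mul, ENNReal.toReal_inv]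
    rfl
  have he : 0 < μ.real E := ENNReal.toReal_pos h0 (measure_ne_top _ _)
  rw [← hE, hcond, hcond, mul_div_mul_left _ _ (inv_ne_zero he.ne')] at hmem
  set P := μ.real (E ∩ {ω | X ω i = 1})
  set M := μ.real (E ∩ {ω | X ω i = -1})
  have hM : 0 < M := by
    -- If `M = 0`, the quotient takes the default value `0`, below `a`.
    refine lt_of_le_of_ne measureReal_nonneg fun hM => ?_
    rw [← hM, div_zero] at hmem
    exact absurd hmem.1 (not_le.2 ha)
  have h1 : a * M ≤ P := (le_div_iff₀ hM).1 hmem.1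
  have h2 : P ≤ 1 / a * M := (div_le_iff₀ hM).1 hmem.2
  have h1' : M ≤ 1 / a * P := by
    rw [div_mul_eq_mul_div, one_mul, le_div_iff₀ ha]
    linarith
  have hfib : X ⁻¹' {x} = E ∩ {ω | X ω i = x i} := by
    ext ω
    refine ⟨fun hω => ?_, fun hω => funext fun j => ?_⟩
    · have hω' : X ω = x := hω
      exact ⟨fun j _ => congrFun hω' j, congrFun hω' i⟩
    · by_cases hj : j = i
      · subst hj; exact hω.2
      · exact hω.1 j hj
  have hfib' : X ⁻¹' {flipAt i x} = E ∩ {ω | X ω i = -x i} := by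
    ext ω
    refine ⟨fun hω => ⟨hsub hω, ?_⟩, fun hω => funext fun j => ?_⟩
    · show X ω i = -x i
      rw [show X ω = flipAt i x from hω, flipAt_same]
    · by_cases hj : j = i
      · subst hj; rw [flipAt_same]; exact hω.2
      · rw [flipAt_of_ne hj]; exact hω.1 j hj
  rw [hfib, hfib']
  rcases Int.units_eq_one_or (x i) with hx | hx
  · simpa only [hx] using h1'
  · simpa only [hx, neg_neg] using h2

/-- A nonzero mass function with bounded ratios under flips has full support. -/
lemma pos_of_flipAt_le {n : ℕ} {q : (Fin n → ℤˣ) → ℝ} (hq : ∀ y, 0 ≤ q y) (hq1 : ∑ y, q y = 1)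
    {C : ℝ} (hqC : ∀ i y, q (flipAt i y) ≤ C * q y) (y : Fin n → ℤˣ) : 0 < q y := by
  have hflip : ∀ i y, 0 < q y → 0 < q (flipAt i y) := by
    intro i y hy
    refine lt_of_le_of_ne (hq _) fun h => ?_
    have := hqC i (flipAt i y)
    rw [flipAt_flipAt, ← h, mul_zero] at this
    linarith
  obtain ⟨x, hx⟩ : ∃ x, 0 < q x := by
    by_contra hcon
    push Not at hcon
    have : ∑ y, q y ≤ 0 := Finset.sum_nonpos fun y _ => hcon y
    linarith
  -- Walk from a point `x` of the support to `y`, changing one coordinate at a time.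
  have key : ∀ s : Finset (Fin n), 0 < q (fun j => if j ∈ s then y j else x j) := by
    intro s
    induction s using Finset.induction_on with
    | empty => simpa using hx
    | insert i s hi ih =>
      by_cases e : y i = x i
      · convert ih using 2
        ext j
        by_cases hj : j = i
        · subst hj; simp [e]
        · simp [hj]
      · convert hflip i _ ih using 2
        ext j
        by_cases hj : j = i
        · subst hj; simp [hi, Int.units_ne_iff_eq_neg.1 e]
        · simp [hj, flipAt_of_ne hj]
  simpa using key Finset.univ

/-- The inner product of two independent strong Santha-Vazirani sources is spread over the
residue classes modulo `m ≈ √n`. -/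
theorem measureReal_signInner_dvd_le {Ω : Type*} [MeasurableSpace Ω] {μ : Measure Ω}
    [IsProbabilityMeasure μ] {n : ℕ} (hn : 2 ≤ n) {ε : ℝ} (hε : 0 ≤ ε) {X Y : Ω → Fin n → ℤˣ}
    (hX : Measurable X) (hY : Measurable Y) (hXY : IndepFun X Y μ)
    (hsX : IsStrongSVSource μ (Real.exp (-ε)) X) (hsY : IsStrongSVSource μ (Real.exp (-ε)) Y)
    {m : ℕ} (hm : √n ≤ m) (hm' : m ≤ √n + 1) (z : ℤ) :
    μ.real {ω | (m : ℤ) ∣ signInner (X ω) (Y ω) - z}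
      ≤ 28 * Real.exp ε ^ 2 * Real.logb 2 n / √n := by
  have hexp : 1 / Real.exp (-ε) = Real.exp ε := by rw [Real.exp_neg, one_div, inv_inv]
  have hpC := fun i x => hsX.measureReal_flipAt_le (Real.exp_pos _) hX i x
  have hqC := fun i x => hsY.measureReal_flipAt_le (Real.exp_pos _) hY i x
  simp only [hexp] at hpC hqC
  have hp1 := sum_measureReal_fiber (μ := μ) hX
  have hq1 := sum_measureReal_fiber (μ := μ) hY
  refine le_trans (le_of_eq ?_) (sum_signInner_dvd_le hn (fun x => measureReal_nonneg) hp1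
    (pos_of_flipAt_le (fun y => measureReal_nonneg) hq1 hqC) hq1 (Real.one_le_exp hε) hpC hqC
    hm hm' z)
  set Z : Ω → (Fin n → ℤˣ) × (Fin n → ℤˣ) := fun ω => (X ω, Y ω) with hZ
  have hZm : Measurable Z := hX.prodMk hY
  have hset : {ω | (m : ℤ) ∣ signInner (X ω) (Y ω) - z}
      = Z ⁻¹' ((Finset.univ.filter fun a : (Fin n → ℤˣ) × (Fin n → ℤˣ) =>
        (m : ℤ) ∣ signInner a.1 a.2 - z : Finset _) : Set _) := by
    ext ω; simp [hZ]
  rw [hset, ← sum_measureReal_preimage_singleton _ fun y _ => hZm (measurableSet_singleton y),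
    Finset.sum_filter]
  refine Finset.sum_congr rfl fun a _ => ?_
  have : μ.real (Z ⁻¹' {a}) = μ.real (X ⁻¹' {a.1}) * μ.real (Y ⁻¹' {a.2}) := by
    have e : Z ⁻¹' {a} = X ⁻¹' {a.1} ∩ Y ⁻¹' {a.2} := by
      ext ω; simp [hZ, Prod.ext_iff]
    rw [e, measureReal_def, hXY.measure_inter_preimage_eq_mul _ _ (measurableSet_singleton _)
      (measurableSet_singleton _), ENNReal.toReal_mul]
    rfl
  rw [this]

/-! ### Min-entropy and conclusion. -/

/-- A bound on all point masses of a discrete random variable bounds its min-entropy below. -/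
lemma logb_inv_le_minEntropy {Ω S : Type*} [MeasurableSpace Ω] {μ : Measure Ω}
    [IsProbabilityMeasure μ] [Countable S] (Z : Ω → S) {B : ℝ}
    (hB : ∀ z, μ.real {ω | Z ω = z} ≤ B) : Real.logb 2 B⁻¹ ≤ minEntropy μ Z := by
  -- Monotonicity of the logarithm needs a positive supremum; countability of `S` provides an atom.
  obtain ⟨z, hz⟩ : ∃ z, 0 < μ.real {ω | Z ω = z} := by
    by_contra hcon
    push Not at hcon
    have h0 : ∀ z, μ {ω | Z ω = z} = 0 := fun z =>
      (measureReal_eq_zero_iff (by finiteness)).1 (le_antisymm (hcon z) measureReal_nonneg)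
    have huniv : (Set.univ : Set Ω) = ⋃ z, {ω | Z ω = z} := by ext ω; simp
    have := measure_iUnion_null h0
    rw [← huniv, measure_univ] at this
    exact one_ne_zero this
  have : Nonempty S := ⟨z⟩
  have hbdd : BddAbove (Set.range fun z => μ.real {ω | Z ω = z}) := by
    refine ⟨B, ?_⟩
    rintro _ ⟨z, rfl⟩
    exact hB z
  have hpos : 0 < ⨆ z, μ.real {ω | Z ω = z} := hz.trans_le (le_ciSup hbdd z)
  rw [minEntropy, Real.logb_inv]
  exact neg_le_neg (Real.logb_le_logb_of_le (by norm_num) hpos (ciSup_le hB))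

theorem mainTheorem4 :
    ∃ c₁ c₂ : ℝ, 0 < c₁ ∧ 0 < c₂ ∧
      ∀ (n : ℕ) (_ : 2 ≤ n) (ε : ℝ) (_ : 0 ≤ ε)
        (Ω : Type*) [MeasurableSpace Ω] (μ : Measure Ω) [IsProbabilityMeasure μ]
        (X Y : Ω → Fin n → ℤˣ) (_ : Measurable X) (_ : Measurable Y)
        (_ : IndepFun X Y μ)
        (_ : IsStrongSVSource μ (Real.exp (-ε)) X)
        (_ : IsStrongSVSource μ (Real.exp (-ε)) Y),
        Real.logb 2 (√(n : ℝ) / (Real.exp (c₁ * ε) * c₁ * Real.logb 2 (n : ℝ))) ≤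
            minEntropy μ (fun ω => signInner (X ω) (Y ω)) ∧
          Real.logb 2 (√(n : ℝ) / (Real.exp (c₁ * ε) * c₁ * Real.logb 2 (n : ℝ))) ≤
            minEntropy μ (fun ω => signInner (X ω) (Y ω) % ⌈c₂ * √(n : ℝ)⌉) := by
  refine ⟨28, 1, by norm_num, one_pos, ?_⟩
  intro n hn ε hε Ω _ μ _ X Y hX hY hXY hsX hsY
  have hn1 : (1 : ℝ) ≤ n := by exact_mod_cast (by omega : 1 ≤ n)
  have hL : 0 ≤ Real.logb 2 (n : ℝ) := Real.logb_nonneg (by norm_num) hn1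
  set m : ℕ := ⌈√(n : ℝ)⌉₊ with hm
  have hceil : ⌈1 * √(n : ℝ)⌉ = (m : ℤ) := by
    rw [one_mul, hm, Int.natCast_ceil_eq_ceil (Real.sqrt_nonneg _)]
  have hbound : ∀ z : ℤ, μ.real {ω | (m : ℤ) ∣ signInner (X ω) (Y ω) - z}
      ≤ Real.exp (28 * ε) * 28 * Real.logb 2 (n : ℝ) / √n := by
    intro z
    refine (measureReal_signInner_dvd_le hn hε hX hY hXY hsX hsY (Nat.le_ceil _)
      (Nat.ceil_lt_add_one (Real.sqrt_nonneg _)).le z).trans ?_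
    have h1 : Real.exp ε ^ 2 ≤ Real.exp (28 * ε) := by
      rw [← Real.exp_nat_mul]
      exact Real.exp_le_exp.2 (by push_cast; linarith)
    rw [mul_comm (28 : ℝ)]
    gcongr
  rw [hceil, ← inv_div (Real.exp (28 * ε) * 28 * Real.logb 2 (n : ℝ))]
  -- Both `⟨X, Y⟩ = z` and `⟨X, Y⟩ % m = z` force `m ∣ ⟨X, Y⟩ - z`, so `hbound` serves for both.
  refine ⟨logb_inv_le_minEntropy _ fun z => ?_, logb_inv_le_minEntropy _ fun z => ?_⟩
  · refine (measureReal_mono fun ω hω => ?_).trans (hbound z)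
    have hω' : signInner (X ω) (Y ω) = z := hω
    simp [hω']
  · refine (measureReal_mono fun ω hω => ?_).trans (hbound z)
    have hω' : signInner (X ω) (Y ω) % (m : ℤ) = z := hω
    show (m : ℤ) ∣ signInner (X ω) (Y ω) - z
    rw [← hω']
    exact Int.dvd_self_sub_emod
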